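/- Let $N\ge 1$. A deck is a permutation $d$ of $[N]=\{0,\dots,N-1\}$, where $d(p)$ is the card at position $p$ and position $0$ is the top. One step of the inverse uniform riffle shuffle draws a bit vector $b\in\{0,1\}^N$ uniformly at random and replaces $d$ by the deck $d^b$ in which the cards $d(p)$ with $b(p)=0$, in their relative order, lie on top of the cards $d(p)$ with $b(p)=1$, in their relative order. Let $\mathbf{riffle}(d,N,K)$ be the distribution of the deck after $K\in\mathbb N$ independent steps from $d$, let $U_N$ be the uniform distribution on the permutations of $[N]$, and let $TV(\mu,\nu)=\frac12\sum_x|\mu(x)-\nu(x)|$. For two decks $d_1,d_2$ let $\pi=d_2^{-1}\circ d_1$, and consider the partitions of the set of positions $[N]$ into contiguous blocks each of which is mapped to itself by $\pi$; there is a finest one. Let $B_{d_1,d_2}(c)$ be its block containing $d_1^{-1}(c)$, and $$d_M(d_1,d_2)=\frac1{N^2}\sum_{c\in[N]}\bigl(|B_{d_1,d_2}(c)|-1\bigr).$$ Then: 1. For all $N\ge1$, all decks $d_1,d_2$ and all $K\in\mathbb N$, $TV(\mathbf{riffle}(d_1,N,K),\mathbf{riffle}(d_2,N,K))\le N^2(1/2)^K$.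 2. For all $N\ge1$ and all decks $d_1,d_2$, let $b_1$ be uniform on $\{0,1\}^N$ and let $b_2=b_1\circ d_1^{-1}\circ d_2$, so that every card gets the same bit in both decks. Then $(d_1^{b_1},d_2^{b_2})$ is a coupling of one step from $d_1$ and one step from $d_2$, and $\mathbb E\bigl[d_M(d_1^{b_1},d_2^{b_2})\bigr]\le\frac12\,d_M(d_1,d_2)$. 3. For all $N\ge1$, all decks $d$ and all $K\in\mathbb N$, $TV(\mathbf{riffle}(d,N,K),U_N)\le N^2(1/2)^K$. 4. There is a constant $C$ such that for all $N\ge1$, all integers $K\ge 3\log_2 N$ and all decks $d$, $TV(\mathbf{riffle}(d,N,K),U_N)\le C/N$. In particular, for $K=\lceil 3\log_2N\rceil$ the distance to uniform is $O(1/N)$, uniformly in the initial deck. -/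

import Mathlib

open scoped BigOperators

noncomputable section

namespace Riffle

/-- A deck of `N` cards: `d p` is the card at position `p` (position `0` is the top), and
`d.symm c` is the position of the card `c`. Cards are named by `0, …, N - 1`. -/
abbrev Deck (N : ℕ) : Type := Equiv.Perm (Fin N)

/-- One deterministic step of the inverse riffle shuffle: the card at position `p` carries the bit
`b p`; the cards with bit `0` (`false`) are put on top of the cards with bit `1` (`true`), and
cards with the same bit keep their relative order. `Tuple.sort b` is the permutation which sorts
the tuple `b` stably. See `ofFn_split` for the description by concatenation. -/
def split {N : ℕ} (b : Fin N → Bool) (d : Deck N) : Deck N :=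
  (Tuple.sort b).trans d

/-- Total variation distance of two distributions on a finite type. -/
def tvDist {α : Type*} [Fintype α] (μ ν : PMF α) : ℝ :=
  (1 / 2) * ∑ x, |(μ x).toReal - (ν x).toReal|

/-- One random step of the inverse uniform riffle shuffle: the `N` bits are sampled uniformly. -/
def riffleStep {N : ℕ} (d : Deck N) : PMF (Deck N) :=
  (PMF.uniformOfFintype (Fin N → Bool)).map (fun b => split b d)

/-- The distribution of the deck after `K` steps of the inverse uniform riffle shuffle. -/
def riffle {N : ℕ} (d : Deck N) : ℕ → PMF (Deck N)
  | 0 => PMF.pure d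
  | K + 1 => (riffle d K).bind riffleStep

/-- A block decomposition of a permutation `π` of the positions, given as an equivalence relation:
a partition of the positions in contiguous blocks, each of which is mapped to itself by `π`. -/
def IsBlockDecomposition {N : ℕ} (π : Equiv.Perm (Fin N)) (s : Setoid (Fin N)) : Prop :=
  (∀ p, s p (π p)) ∧ ∀ p, {q | s p q}.OrdConnected

/-- The minimal (finest) block decomposition of `π`. -/
def minBlockDecomposition {N : ℕ} (π : Equiv.Perm (Fin N)) : Setoid (Fin N) :=
  sInf {s | IsBlockDecomposition π s}

/-- The finest block decomposition is indeed the least block decomposition. -/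
theorem isLeast_minBlockDecomposition {N : ℕ} (π : Equiv.Perm (Fin N)) :
    IsLeast {s | IsBlockDecomposition π s} (minBlockDecomposition π) := by
  refine ⟨⟨fun p s hs => hs.1 p, fun p => ⟨?_⟩⟩, fun s hs => sInf_le hs⟩
  intro x hx y hy z hz s hs
  exact (hs.2 p).out (hx s hs) (hy s hs) hz

/-- The number of positions in the block of card `c`, in the minimal block decomposition of the
permutation of positions which takes the position of each card in `d₁` to its position in `d₂`. -/
def blockSize {N : ℕ} (d₁ d₂ : Deck N) (c : Fin N) : ℕ :=
  {q | minBlockDecomposition (d₁.trans d₂.symm) (d₁.symm c) q}.ncard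

/-- The block decomposition distance of two decks. -/
def blockDist {N : ℕ} (d₁ d₂ : Deck N) : ℝ :=
  (1 / (N : ℝ) ^ 2) * ∑ c, ((blockSize d₁ d₂ c : ℝ) - 1)

/-- One step of two coupled shuffles, in which every card `c` gets the same bit in both decks:
`b₁ (d₁.symm c) = b₂ (d₂.symm c)`, where `b₁` is uniform. -/
def coupledStep {N : ℕ} (d₁ d₂ : Deck N) : PMF (Deck N × Deck N) :=
  (PMF.uniformOfFintype (Fin N → Bool)).map
    (fun b => (split b d₁, split (fun q => b (d₁.symm (d₂ q))) d₂))

/-- `split b d`, read from top to bottom, is the concatenation of the subsequence of the cards of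
`d` at the positions with bit `0` and the subsequence of those at the positions with bit `1`. -/
theorem ofFn_split {N : ℕ} (b : Fin N → Bool) (d : Deck N) :
    List.ofFn (split b d) =
      ((List.finRange N).filter (fun p => !b p)).map d ++
        ((List.finRange N).filter (fun p => b p)).map d := by
  rw [← List.map_append]
  have key : List.ofFn (Tuple.sort b) =
      (List.finRange N).filter (fun p => !b p) ++ (List.finRange N).filter (fun p => b p) := by
    have hlt : ∀ {i j : Fin N}, i < j →
        toLex (b (Tuple.sort b i), Tuple.sort b i) < toLex (b (Tuple.sort b j), Tuple.sort b j) := by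
      intro i j hij
      have hm := Tuple.monotone_sort b hij.le
      rw [Prod.Lex.lt_iff]
      rcases hm.lt_or_eq with h | h
      · exact Or.inl h
      · refine Or.inr ⟨h, ?_⟩
        exact (Tuple.eq_sort_iff.1 rfl).2 i j hij h
    refine List.Perm.eq_of_pairwise
      (le := fun p q => toLex (b p, p) < toLex (b q, q)) ?_ ?_ ?_ ?_
    · intro x y _ _ h h'
      exact absurd h' (not_lt_of_gt h)
    · rw [List.pairwise_ofFn]
      intro i j hij
      exact hlt hij
    · rw [List.pairwise_append]
      refine ⟨?_, ?_, ?_⟩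
      · rw [List.pairwise_filter]
        refine (List.pairwise_lt_finRange N).imp ?_
        intro x y hxy hx hy
        rw [Prod.Lex.lt_iff]
        right
        simp at hx hy
        simp [hx, hy, hxy]
      · rw [List.pairwise_filter]
        refine (List.pairwise_lt_finRange N).imp ?_
        intro x y hxy hx hy
        rw [Prod.Lex.lt_iff]
        right
        simp [hx, hy, hxy]
      · intro x hx y hy
        simp at hx hy
        rw [Prod.Lex.lt_iff]
        left
        simp [hx, hy]
    · refine (List.perm_ext_iff_of_nodup ?_ ?_).2 ?_
      · exact List.nodup_ofFn.2 (Tuple.sort b).injective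
      · refine List.Nodup.append ((List.nodup_finRange N).filter _)
          ((List.nodup_finRange N).filter _) ?_
        intro x hx hy
        simp at hx hy
        simp [hx] at hy
      · intro x
        have h1 : x ∈ List.ofFn (Tuple.sort b) := by
          rw [List.mem_ofFn]
          exact (Tuple.sort b).surjective x
        simp only [h1, true_iff, List.mem_append, List.mem_filter, List.mem_finRange, true_and]
        cases b x <;> simp
  rw [← key, List.map_ofFn]
  rfl

end Riffle

end

/-! Couple two shuffles by giving each card the same bit in both decks. A block occupies the same
positions and holds the same cards in both, so after a step its cards with a given bit fill the same
interval in both new decks. Hence a new block lies inside one old block and one bit value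
(`blockSize_split_le`). Any other card of the block shares the bit with probability 1/2, so the mean
of |B| - 1 at least halves (`sum_coupledStep_blockDist_le`). Since `N ^ 2 * blockDist` is at least 1
on distinct decks, it bounds the total variation at time 0; convexity of total variation carries the
contraction through K steps. The uniform law is stationary, so averaging over the second deck
compares with it. -/

namespace Riffle

/-! ### Finite sums against probability mass functions -/

section PMFSums

variable {α β : Type*} [Fintype α]

theorem toReal_bind_apply (μ : PMF α) (f : α → PMF β) (y : β) :
    (μ.bind f y).toReal = ∑ x, (μ x).toReal * (f x y).toReal := by
  rw [PMF.bind_apply, tsum_fintype, ENNReal.toReal_sum]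
  · simp only [ENNReal.toReal_mul]
  · exact fun x _ => ENNReal.mul_ne_top (μ.apply_ne_top x) ((f x).apply_ne_top y)

theorem sum_toReal_eq_one (μ : PMF α) : ∑ x, (μ x).toReal = 1 := by
  rw [← ENNReal.toReal_sum fun x _ => μ.apply_ne_top x, ← tsum_fintype (L := .unconditional α),
    μ.tsum_coe]
  rfl

theorem sum_map_toReal_mul [Fintype β] (μ : PMF α) (g : α → β) (h : β → ℝ) :
    ∑ y, ((μ.map g) y).toReal * h y = ∑ x, (μ x).toReal * h (g x) := by
  classical
  have key : ∀ y, ((μ.map g) y).toReal = ∑ x, (μ x).toReal * if y = g x then 1 else 0 := by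
    intro y
    rw [← PMF.bind_pure_comp, toReal_bind_apply]
    refine Finset.sum_congr rfl fun x _ => ?_
    simp only [Function.comp_apply, PMF.pure_apply]
    split_ifs <;> simp
  simp only [key, Finset.sum_mul]
  rw [Finset.sum_comm]
  simp

theorem sum_uniformOfFintype_mul [Nonempty α] (h : α → ℝ) :
    ∑ x, (PMF.uniformOfFintype α x).toReal * h x = (Fintype.card α : ℝ)⁻¹ * ∑ x, h x := by
  simp [Finset.mul_sum]

theorem map_uniformOfFintype_equiv [Fintype β] [Nonempty α] [Nonempty β] (e : α ≃ β) :
    (PMF.uniformOfFintype α).map e = PMF.uniformOfFintype β := by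
  classical
  ext y
  rw [PMF.map_apply, tsum_eq_single (e.symm y)]
  · simp [Fintype.card_congr e]
  · intro x hx
    rw [if_neg]
    rintro rfl
    simp at hx

end PMFSums

/-! ### Total variation and its convexity -/

section TotalVariation

variable {α β γ : Type*} [Fintype α] [Fintype β] [Fintype γ]

theorem tvDist_le_one (μ ν : PMF α) : tvDist μ ν ≤ 1 := by
  have h : ∑ x, |(μ x).toReal - (ν x).toReal| ≤ ∑ x, ((μ x).toReal + (ν x).toReal) :=
    Finset.sum_le_sum fun x _ => (abs_sub _ _).trans_eq (by simp)
  rw [Finset.sum_add_distrib, sum_toReal_eq_one, sum_toReal_eq_one] at h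
  unfold tvDist
  linarith

@[simp] theorem tvDist_self (μ : PMF α) : tvDist μ μ = 0 := by simp [tvDist]

/-- The total variation distance of two mixtures with the same weights is at most the mean of the
distances of their components. -/
theorem tvDist_bind_le (μ : PMF γ) (f g : γ → PMF α) :
    tvDist (μ.bind f) (μ.bind g) ≤ ∑ z, (μ z).toReal * tvDist (f z) (g z) := by
  have h : ∑ x, |(μ.bind f x).toReal - (μ.bind g x).toReal| ≤
      ∑ x, ∑ z, (μ z).toReal * |(f z x).toReal - (g z x).toReal| := by
    refine Finset.sum_le_sum fun x _ => ?_
    rw [toReal_bind_apply, toReal_bind_apply, ← Finset.sum_sub_distrib]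
    refine (Finset.abs_sum_le_sum_abs _ _).trans_eq (Finset.sum_congr rfl fun z _ => ?_)
    rw [← mul_sub, abs_mul, abs_of_nonneg ENNReal.toReal_nonneg]
  rw [Finset.sum_comm] at h
  calc tvDist (μ.bind f) (μ.bind g)
      ≤ (1 / 2) * ∑ z, ∑ x, (μ z).toReal * |(f z x).toReal - (g z x).toReal| :=
        mul_le_mul_of_nonneg_left h (by norm_num)
    _ = ∑ z, (μ z).toReal * tvDist (f z) (g z) := by
        rw [Finset.mul_sum]
        refine Finset.sum_congr rfl fun z _ => ?_
        rw [tvDist, ← Finset.mul_sum]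
        ring

end TotalVariation

/-! ### Block decompositions and contraction of the block distance -/

section Blocks

variable {N : ℕ}

/-- Two monotone tuples which are rearrangements of each other by `π` are equal, so that `π`
preserves the level sets. -/
theorem isBlockDecomposition_ker {α : Type*} [LinearOrder α] {f g : Fin N → α}
    (hf : Monotone f) (hg : Monotone g) (π : Equiv.Perm (Fin N)) (h : g ∘ π = f) :
    IsBlockDecomposition π (Setoid.ker f) := by
  have hfg : f = g := by
    have := Tuple.unique_monotone (f := g) (σ := π) (τ := 1) (by rwa [h]) hg
    rw [← h, this]
    rfl
  refine ⟨fun p => ?_, fun p => ⟨fun x hx y hy z hz => ?_⟩⟩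
  · change f p = f (π p)
    rw [← congrFun h p, hfg]
    rfl
  · change f p = f z
    have hx : f p = f x := hx
    have hy : f p = f y := hy
    exact le_antisymm (hx.trans_le (hf hz.1)) ((hf hz.2).trans_eq hy.symm)

/-- An equivalence relation with contiguous classes is the kernel of a monotone tuple. -/
theorem exists_monotone_ker_eq (s : Setoid (Fin N)) (hs : ∀ p, {q | s p q}.OrdConnected) :
    ∃ f : Fin N → Fin N, Monotone f ∧ Setoid.ker f = s := by
  classical
  let F : Fin N → Finset (Fin N) := fun p => {q | s p q}
  have hF : ∀ p, (F p).Nonempty := fun p => ⟨p, by simp [F]⟩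
  -- Each position is labelled by the least element of its class.
  let f : Fin N → Fin N := fun p => (F p).min' (hF p)
  have hmem : ∀ p, s p (f p) := fun p => by
    have := (F p).min'_mem (hF p)
    simpa [F] using this
  have hle : ∀ p q, s p q → f p ≤ q := fun p q hq => (F p).min'_le q (by simpa [F] using hq)
  have hiff : ∀ p q, f p = f q ↔ s p q := by
    intro p q
    constructor
    · intro h
      exact s.trans' (hmem p) (h ▸ s.symm' (hmem q))
    · intro h
      exact le_antisymm (hle _ _ (s.trans' h (hmem q)))
        (hle _ _ (s.trans' (s.symm' h) (hmem p)))
  refine ⟨f, fun p q hpq => ?_, Setoid.ext fun p q => hiff p q⟩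
  by_contra! hlt
  have hp : f p ≤ p := hle p p (s.refl' p)
  -- Here `f q < f p ≤ p ≤ q`, so `p` lies between two members of the contiguous class of `q`.
  have hsp : s q p := (hs q).out (hmem q) (s.refl' q) ⟨(hlt.le.trans hp), hpq⟩
  exact hlt.ne ((hiff q p).2 hsp)

/-- The block of a card, after one step in which every card gets the same bit in both decks,
consists of cards of its former block with the same bit. -/
theorem blockSize_split_le (d₁ d₂ : Deck N) (b : Fin N → Bool) (p : Fin N) :
    blockSize (split b d₁) (split (fun q => b (d₁.symm (d₂ q))) d₂) (d₁ p) ≤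
      {q | minBlockDecomposition (d₁.trans d₂.symm) p q ∧ b p = b q}.ncard := by
  set π := d₁.trans d₂.symm
  set b₂ : Fin N → Bool := fun q => b (d₁.symm (d₂ q))
  have hblock := (isLeast_minBlockDecomposition π).1
  obtain ⟨r, hr, hker⟩ := exists_monotone_ker_eq _ hblock.2
  have hiff : ∀ p q, minBlockDecomposition π p q ↔ r p = r q := fun p q => by
    rw [← hker, Setoid.ker_def]
  -- Stability of the sort: among equal bits the old order, hence the order of blocks, survives.
  have hmono : ∀ b : Fin N → Bool,
      Monotone fun p => toLex (b (Tuple.sort b p), r (Tuple.sort b p)) := by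
    intro b
    refine monotone_iff_forall_lt.2 fun i j hij => ?_
    rw [Prod.Lex.toLex_le_toLex]
    rcases (Tuple.monotone_sort b hij.le).lt_or_eq with h | h
    · exact Or.inl h
    · exact Or.inr ⟨h, hr ((Tuple.eq_sort_iff.1 rfl).2 i j hij h).le⟩
  set f : Fin N → Bool ×ₗ Fin N := fun p => toLex (b (Tuple.sort b p), r (Tuple.sort b p))
  -- A card has the same label (bit, old block) in both decks: its bits agree by the coupling, and
  -- its two old positions lie in one block.
  have hdec : IsBlockDecomposition ((split b d₁).trans (split b₂ d₂).symm) (Setoid.ker f) := by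
    refine isBlockDecomposition_ker (hmono b) (hmono b₂) _ (funext fun i => ?_)
    have h1 : r (d₂.symm (d₁ (Tuple.sort b i))) = r (Tuple.sort b i) :=
      ((hiff _ _).1 (hblock.1 (Tuple.sort b i))).symm
    simp [split, b₂, h1]
  have hsub : {q | minBlockDecomposition ((split b d₁).trans (split b₂ d₂).symm)
      ((split b d₁).symm (d₁ p)) q} ⊆
      (Tuple.sort b) ⁻¹' {q | minBlockDecomposition π p q ∧ b p = b q} := by
    intro q hq
    have h : f ((split b d₁).symm (d₁ p)) = f q := hq _ hdec
    simp only [f, split, Equiv.symm_trans_apply, Equiv.symm_apply_apply, Equiv.apply_symm_apply,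
      EmbeddingLike.apply_eq_iff_eq, Prod.mk.injEq] at h
    exact ⟨(hiff _ _).2 h.2, h.1⟩
  refine (Set.ncard_le_ncard hsub (Set.toFinite _)).trans_eq ?_
  exact Set.ncard_preimage_of_injective_subset_range (Tuple.sort b).injective
    (by simp [(Tuple.sort b).surjective.range_eq])

/-- A position agrees with another one in half of the bit vectors. -/
theorem two_mul_card_bits_eq {p q : Fin N} (h : p ≠ q) :
    2 * (Finset.univ.filter fun b : Fin N → Bool => b p = b q).card =
      Fintype.card (Fin N → Bool) := by
  classical
  -- Flipping the bit at `p` is an involution exchanging agreement and disagreement with `q`.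
  have hflip : (Finset.univ.filter fun b : Fin N → Bool => b p = b q).card =
      (Finset.univ.filter fun b : Fin N → Bool => ¬ b p = b q).card := by
    have hinv : ∀ b : Fin N → Bool,
        Function.update (Function.update b p (!b p)) p
          (!(Function.update b p (!b p)) p) = b := by
      intro b
      simp
    refine Finset.card_bij' (fun b _ => Function.update b p (!b p))
      (fun b _ => Function.update b p (!b p)) ?_ ?_ (fun b _ => hinv b) (fun b _ => hinv b)
    · intro b hb
      simpa [Function.update_of_ne h.symm] using hb
    · intro b hb
      simp only [Finset.mem_filter, Finset.mem_univ, true_and] at hb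
      simp only [Finset.mem_filter, Finset.mem_univ, true_and, Function.update_self,
        Function.update_of_ne h.symm]
      cases h1 : b p <;> cases h2 : b q <;> simp_all
  have := Finset.card_filter_add_card_filter_not (s := Finset.univ)
    (fun b : Fin N → Bool => b p = b q)
  rw [Finset.card_univ] at this
  omega

/-- The mean number of the other elements of `S` which get the same bit as the element `p`. -/
theorem mean_card_same_bit (S : Set (Fin N)) {p : Fin N} (hp : p ∈ S) :
    (Fintype.card (Fin N → Bool) : ℝ)⁻¹ *
      ∑ b : Fin N → Bool, (({q | q ∈ S ∧ b p = b q}.ncard : ℝ) - 1) =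
      (1 / 2) * ((S.ncard : ℝ) - 1) := by
  classical
  -- Removing `p`, which always agrees with itself, absorbs the `- 1` on both sides.
  set T : Finset (Fin N) := S.toFinset.erase p
  have h1 : ∀ b : Fin N → Bool, ({q | q ∈ S ∧ b p = b q}.ncard : ℝ) - 1 =
      ∑ q ∈ T, if b p = b q then 1 else 0 := by
    intro b
    have : {q | q ∈ S ∧ b p = b q} = ↑(insert p (T.filter fun q => b p = b q)) := by
      ext q
      by_cases hq : q = p
      · simp [hq, hp]
      · simp [hq, T]
    rw [this, Set.ncard_coe_finset, Finset.card_insert_of_notMem (by simp [T])]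
    simp
  have h2 : (S.ncard : ℝ) - 1 = T.card := by
    rw [Set.ncard_eq_toFinset_card', ← Finset.card_erase_add_one (Set.mem_toFinset.2 hp)]
    simp [T]
  have hcard : (Fintype.card (Fin N → Bool) : ℝ) ≠ 0 := Nat.cast_ne_zero.2 Fintype.card_ne_zero
  have h3 : ∀ q ∈ T, ∑ b : Fin N → Bool, (if b p = b q then (1 : ℝ) else 0) =
      (1 / 2) * Fintype.card (Fin N → Bool) := by
    intro q hq
    rw [← two_mul_card_bits_eq (Finset.ne_of_mem_erase hq).symm]
    push_cast
    simp
  simp only [h1]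
  rw [Finset.sum_comm, Finset.sum_congr rfl h3, h2, Finset.sum_const, nsmul_eq_mul]
  field_simp

theorem sum_coupledStep_blockDist_le (d₁ d₂ : Deck N) :
    ∑ x, ((coupledStep d₁ d₂) x).toReal * blockDist x.1 x.2 ≤ (1 / 2) * blockDist d₁ d₂ := by
  unfold coupledStep
  rw [sum_map_toReal_mul _ _ fun x : Deck N × Deck N => blockDist x.1 x.2,
    sum_uniformOfFintype_mul]
  set s := minBlockDecomposition (d₁.trans d₂.symm)
  set c : ℝ := (Fintype.card (Fin N → Bool) : ℝ)⁻¹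
  calc c * ∑ b, blockDist (split b d₁) (split (fun q => b (d₁.symm (d₂ q))) d₂)
      ≤ c * ∑ b : Fin N → Bool, (1 / (N : ℝ) ^ 2) *
          ∑ p, (({q | q ∈ {q | s p q} ∧ b p = b q}.ncard : ℝ) - 1) := by
        refine mul_le_mul_of_nonneg_left (Finset.sum_le_sum fun b _ => ?_) (by positivity)
        refine mul_le_mul_of_nonneg_left ?_ (by positivity)
        rw [← Equiv.sum_comp d₁]
        refine Finset.sum_le_sum fun p _ => sub_le_sub_right (Nat.cast_le.2 ?_) 1
        exact blockSize_split_le d₁ d₂ b p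
    _ = (1 / (N : ℝ) ^ 2) * ∑ p, c *
          ∑ b : Fin N → Bool, (({q | q ∈ {q | s p q} ∧ b p = b q}.ncard : ℝ) - 1) := by
        rw [← Finset.mul_sum, Finset.sum_comm, ← Finset.mul_sum]
        ring
    _ = (1 / 2) * blockDist d₁ d₂ := by
        rw [Finset.sum_congr rfl fun p _ => mean_card_same_bit {q | s p q} (s.refl' p), blockDist,
          ← Equiv.sum_comp d₁ fun c => (blockSize d₁ d₂ c : ℝ) - 1, ← Finset.mul_sum]
        simp only [blockSize, Equiv.symm_apply_apply]
        ring

theorem one_le_blockSize (d₁ d₂ : Deck N) (c : Fin N) : 1 ≤ blockSize d₁ d₂ c :=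
  (Set.ncard_pos (Set.toFinite _)).2 ⟨d₁.symm c, Setoid.refl' (minBlockDecomposition _) _⟩

theorem blockDist_nonneg (d₁ d₂ : Deck N) : 0 ≤ blockDist d₁ d₂ :=
  mul_nonneg (by positivity) (Finset.sum_nonneg fun c _ =>
    sub_nonneg.2 (Nat.one_le_cast.2 (one_le_blockSize d₁ d₂ c)))

theorem sq_mul_blockDist (hN : 0 < N) (d₁ d₂ : Deck N) :
    (N : ℝ) ^ 2 * blockDist d₁ d₂ = ∑ c, ((blockSize d₁ d₂ c : ℝ) - 1) := by
  have : (N : ℝ) ≠ 0 := by positivity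
  unfold blockDist
  field_simp

theorem blockDist_le_one (hN : 0 < N) (d₁ d₂ : Deck N) : blockDist d₁ d₂ ≤ 1 := by
  have hle : ∀ c, blockSize d₁ d₂ c ≤ N := fun c => by
    unfold blockSize
    simpa only [Nat.card_eq_fintype_card, Fintype.card_fin] using Set.ncard_le_card {q | minBlockDecomposition (d₁.trans d₂.symm) (d₁.symm c) q}
  have h : ∑ c, ((blockSize d₁ d₂ c : ℝ) - 1) ≤ ∑ _c : Fin N, (N : ℝ) :=
    Finset.sum_le_sum fun c _ => by
      have : (blockSize d₁ d₂ c : ℝ) ≤ N := Nat.cast_le.2 (hle c)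
      linarith
  rw [← sq_mul_blockDist hN] at h
  simp only [Finset.sum_const, Finset.card_univ, Fintype.card_fin, nsmul_eq_mul] at h
  have : (0 : ℝ) < (N : ℝ) ^ 2 := by positivity
  nlinarith

/-- A card whose position differs between the decks has both its positions in its block, so it alone
contributes at least 1. -/
theorem one_le_sq_mul_blockDist (hN : 0 < N) {d₁ d₂ : Deck N} (h : d₁ ≠ d₂) :
    1 ≤ (N : ℝ) ^ 2 * blockDist d₁ d₂ := by
  obtain ⟨p, hp⟩ : ∃ p, d₁ p ≠ d₂ p := by
    by_contra! hall
    exact h (Equiv.ext hall)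
  have htwo : 2 ≤ blockSize d₁ d₂ (d₁ p) := by
    refine (Set.one_lt_ncard (Set.toFinite _)).2
      ⟨p, ?_, (d₁.trans d₂.symm) p, ?_, fun heq => hp ?_⟩
    · simp
    · simpa using (isLeast_minBlockDecomposition (d₁.trans d₂.symm)).1.1 p
    · exact (Equiv.eq_symm_apply _).1 heq |>.symm
  rw [sq_mul_blockDist hN]
  refine le_trans ?_ (Finset.single_le_sum (f := fun c => (blockSize d₁ d₂ c : ℝ) - 1)
    (fun c _ => sub_nonneg.2 (Nat.one_le_cast.2 (one_le_blockSize d₁ d₂ c)))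
    (Finset.mem_univ (d₁ p)))
  have : (2 : ℝ) ≤ blockSize d₁ d₂ (d₁ p) := by exact_mod_cast htwo
  linarith

end Blocks

/-! ### Coupled shuffles, stationarity and mixing -/

section Shuffle

variable {N : ℕ}

theorem coupledStep_map_fst (d₁ d₂ : Deck N) :
    (coupledStep d₁ d₂).map Prod.fst = riffleStep d₁ := by
  rw [coupledStep, PMF.map_comp]
  rfl

/-- The second bit vector is the first one transported along a bijection of positions, hence again
uniform. -/
theorem coupledStep_map_snd (d₁ d₂ : Deck N) :
    (coupledStep d₁ d₂).map Prod.snd = riffleStep d₂ := by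
  rw [coupledStep, PMF.map_comp, riffleStep]
  conv_rhs =>
    rw [← map_uniformOfFintype_equiv (Equiv.arrowCongr (d₁.trans d₂.symm) (Equiv.refl Bool)),
      PMF.map_comp]
  rfl

/-- Splitting off the first step, rather than the last, lets the coupled step precede the induction
hypothesis for arbitrary decks. -/
theorem riffle_succ' (d : Deck N) (K : ℕ) :
    riffle d (K + 1) = (riffleStep d).bind fun d' => riffle d' K := by
  induction K with
  | zero => simp [riffle]
  | succ K ih =>
    rw [riffle, ih, PMF.bind_bind]
    rfl

/-- Keeping the factor `blockDist` makes the bound inductive: each coupled step gains 1/2 in the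
mean. -/
theorem tvDist_riffle_le_blockDist (hN : 0 < N) (K : ℕ) (d₁ d₂ : Deck N) :
    tvDist (riffle d₁ K) (riffle d₂ K) ≤ (N : ℝ) ^ 2 * (1 / 2 : ℝ) ^ K * blockDist d₁ d₂ := by
  induction K generalizing d₁ d₂ with
  | zero =>
    rw [pow_zero, mul_one]
    rcases eq_or_ne d₁ d₂ with rfl | h
    · rw [tvDist_self]
      exact mul_nonneg (by positivity) (blockDist_nonneg _ _)
    · exact (tvDist_le_one _ _).trans (one_le_sq_mul_blockDist hN h)
  | succ K ih =>
    rw [riffle_succ', riffle_succ', ← coupledStep_map_fst d₁ d₂, ← coupledStep_map_snd d₁ d₂,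
      PMF.bind_map, PMF.bind_map]
    refine (tvDist_bind_le _ _ _).trans ?_
    calc ∑ z, (coupledStep d₁ d₂ z).toReal * tvDist (riffle z.1 K) (riffle z.2 K)
        ≤ ∑ z, (coupledStep d₁ d₂ z).toReal *
            ((N : ℝ) ^ 2 * (1 / 2 : ℝ) ^ K * blockDist z.1 z.2) :=
          Finset.sum_le_sum fun z _ =>
            mul_le_mul_of_nonneg_left (ih z.1 z.2) ENNReal.toReal_nonneg
      _ = (N : ℝ) ^ 2 * (1 / 2 : ℝ) ^ K *
            ∑ z, (coupledStep d₁ d₂ z).toReal * blockDist z.1 z.2 := by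
          rw [Finset.mul_sum]
          exact Finset.sum_congr rfl fun z _ => by ring
      _ ≤ (N : ℝ) ^ 2 * (1 / 2 : ℝ) ^ K * ((1 / 2) * blockDist d₁ d₂) :=
          mul_le_mul_of_nonneg_left (sum_coupledStep_blockDist_le d₁ d₂) (by positivity)
      _ = (N : ℝ) ^ 2 * (1 / 2 : ℝ) ^ (K + 1) * blockDist d₁ d₂ := by ring

theorem tvDist_riffle_le (hN : 0 < N) (d₁ d₂ : Deck N) (K : ℕ) :
    tvDist (riffle d₁ K) (riffle d₂ K) ≤ (N : ℝ) ^ 2 * (1 / 2 : ℝ) ^ K :=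
  (tvDist_riffle_le_blockDist hN K d₁ d₂).trans
    (mul_le_of_le_one_right (by positivity) (blockDist_le_one hN d₁ d₂))

/-- For fixed bits the step is right multiplication by a fixed permutation, a bijection of decks. -/
theorem uniform_bind_riffleStep :
    (PMF.uniformOfFintype (Deck N)).bind riffleStep = PMF.uniformOfFintype (Deck N) := by
  have h : ∀ b : Fin N → Bool, (PMF.uniformOfFintype (Deck N)).map (fun d => split b d) =
      PMF.uniformOfFintype (Deck N) :=
    fun b => map_uniformOfFintype_equiv (Equiv.mulRight (Tuple.sort b))
  simp only [← PMF.bind_pure_comp, Function.comp_def] at h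
  have hstep : (riffleStep : Deck N → PMF (Deck N)) = fun d =>
      (PMF.uniformOfFintype (Fin N → Bool)).bind fun b => PMF.pure (split b d) :=
    funext fun d => (PMF.bind_pure_comp _ _).symm
  rw [hstep, PMF.bind_comm]
  simp only [h, PMF.bind_const]

theorem uniform_bind_riffle (K : ℕ) :
    (PMF.uniformOfFintype (Deck N)).bind (fun d => riffle d K) =
      PMF.uniformOfFintype (Deck N) := by
  induction K with
  | zero => exact PMF.bind_pure _
  | succ K ih =>
    simp only [riffle]
    rw [← PMF.bind_bind, ih, uniform_bind_riffleStep]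

theorem tvDist_riffle_uniform_le (hN : 0 < N) (d : Deck N) (K : ℕ) :
    tvDist (riffle d K) (PMF.uniformOfFintype (Deck N)) ≤ (N : ℝ) ^ 2 * (1 / 2 : ℝ) ^ K := by
  -- Both laws are mixtures over a uniform starting deck: a constant one, and the stationary one.
  have h := tvDist_bind_le (PMF.uniformOfFintype (Deck N)) (fun _ => riffle d K)
    (fun d' => riffle d' K)
  rw [PMF.bind_const, uniform_bind_riffle] at h
  refine h.trans ((Finset.sum_le_sum fun d' _ => mul_le_mul_of_nonneg_left
    (tvDist_riffle_le hN d d' K) ENNReal.toReal_nonneg).trans_eq ?_)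
  rw [← Finset.sum_mul, sum_toReal_eq_one, one_mul]

/-- The hypothesis on `K` amounts to `N ^ 3 ≤ 2 ^ K`, which is why the final constant can be 1. -/
theorem sq_mul_half_pow_le (hN : 0 < N) {K : ℕ} (hK : 3 * Real.logb 2 N ≤ K) :
    (N : ℝ) ^ 2 * (1 / 2 : ℝ) ^ K ≤ 1 / N := by
  have hpos : (0 : ℝ) < N := by positivity
  have h : (N : ℝ) ^ 3 ≤ 2 ^ K := by
    have h1 : Real.logb 2 ((N : ℝ) ^ 3) ≤ K := by
      rw [Real.logb_pow]
      exact_mod_cast hK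
    rw [Real.logb_le_iff_le_rpow (by norm_num) (by positivity)] at h1
    exact_mod_cast h1
  rw [one_div_pow, mul_one_div, div_le_div_iff₀ (by positivity) hpos]
  linarith [h, pow_succ (N : ℝ) 2]

end Shuffle

end Riffle

theorem mainTheorem10 :
    -- any two decks
    (∀ N : ℕ, 0 < N → ∀ (d₁ d₂ : Riffle.Deck N) (K : ℕ),
      Riffle.tvDist (Riffle.riffle d₁ K) (Riffle.riffle d₂ K) ≤ (N : ℝ) ^ 2 * (1 / 2 : ℝ) ^ K) ∧
    -- one step of the coupled shuffles halves the block decomposition distance in expectation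
    (∀ N : ℕ, 0 < N → ∀ d₁ d₂ : Riffle.Deck N,
      (Riffle.coupledStep d₁ d₂).map Prod.fst = Riffle.riffleStep d₁ ∧
      (Riffle.coupledStep d₁ d₂).map Prod.snd = Riffle.riffleStep d₂ ∧
      ∑ x, ((Riffle.coupledStep d₁ d₂) x).toReal * Riffle.blockDist x.1 x.2
        ≤ (1 / 2) * Riffle.blockDist d₁ d₂) ∧
    -- exponential convergence to the uniform distribution
    (∀ N : ℕ, 0 < N → ∀ (d : Riffle.Deck N) (K : ℕ),
      Riffle.tvDist (Riffle.riffle d K) (PMF.uniformOfFintype (Riffle.Deck N))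
        ≤ (N : ℝ) ^ 2 * (1 / 2 : ℝ) ^ K) ∧
    -- the distance to uniform is `O(1/N)`, uniformly in the initial deck
    (∃ C : ℝ, ∀ N : ℕ, 0 < N → ∀ K : ℕ, 3 * Real.logb 2 N ≤ K → ∀ d : Riffle.Deck N,
      Riffle.tvDist (Riffle.riffle d K) (PMF.uniformOfFintype (Riffle.Deck N)) ≤ C / N) := by

  refine ⟨fun N hN d₁ d₂ K => Riffle.tvDist_riffle_le hN d₁ d₂ K,
    fun N _ d₁ d₂ => ⟨Riffle.coupledStep_map_fst d₁ d₂, Riffle.coupledStep_map_snd d₁ d₂,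
      Riffle.sum_coupledStep_blockDist_le d₁ d₂⟩,
    fun N hN d K => Riffle.tvDist_riffle_uniform_le hN d K,
    1, fun N hN K hK d => (Riffle.tvDist_riffle_uniform_le hN d K).trans
      (Riffle.sq_mul_half_pow_le hN hK)⟩
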